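/- All graphs are finite and simple. A graph $G$ is \emph{$k$-choosable} if, for every assignment of a list $L(v)$ of exactly $k$ colors to each vertex $v$, there is a proper coloring $f$ of $G$ with $f(v)\in L(v)$ for all $v$. The \emph{average degree} of a graph $H$ with at least one vertex is $\frac{1}{|V(H)|}\sum_{v\in V(H)}\deg_H(v)$. The \emph{girth} of a graph is the length of its shortest cycle ($\infty$ if it has no cycle). For all natural numbers $g$ and $k$ there is a bipartite graph $G$ with girth at least $g$ that is not $k$-choosable, although every proper subgraph of $G$ with at least one vertex (every subgraph $H\neq G$, not necessarily induced) has average degree at most $2(k-1)$. -/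

import Mathlib

/-- A graph `G` is `k`-choosable if, for every assignment of a list `L v` of exactly `k` colors to
each vertex `v`, there is a proper coloring `f` of `G` with `f v ∈ L v` for all `v`.
Colors are taken from the infinite set `ℕ`, which is no restriction for finite graphs. -/
def SimpleGraph.IsChoosable {V : Type*} (G : SimpleGraph V) (k : ℕ) : Prop :=
  ∀ L : V → Finset ℕ, (∀ v, (L v).card = k) → ∃ f : G.Coloring ℕ, ∀ v, f v ∈ L v

open Classical in
/-- The average degree `(∑ v ∈ V(H), deg_H v) / |V(H)|` of a subgraph `H` of a finite graph
(meaningful when `H` has at least one vertex). -/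
noncomputable def SimpleGraph.Subgraph.averageDegree {V : Type*} [Fintype V] {G : SimpleGraph V}
    (H : G.Subgraph) : ℝ :=
  (∑ v : H.verts, (H.degree v : ℝ)) / (Fintype.card H.verts : ℝ)

/-! Put `d = k - 1`. Take a complete `d`-ary tree of even height and join each leaf to `d` of its
ancestors on odd levels above its parent; odd levels keep the graph bipartite. Join `d + 1` disjoint
copies to a new vertex ρ.

Sparseness: orient tree edges downwards and the added edges from leaf to ancestor. Out-degrees are
at most `d`, except `d + 1` at ρ, which reaches everything. A proper subgraph omits ρ or loses an
out-edge of one of its vertices, so it has at most `d` edges per vertex.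

Choosability: an internal vertex has its own colour and those of its children in its list; a leaf
has its own colour and, for each chosen ancestor, the colour of that ancestor's child towards the
leaf. If the root avoids its own colour, the choices trace a path to a leaf whose colours are all
blocked. So every copy's root takes its own colour, and these colours form the list of ρ.

Girth: induct on the girth and on the number `r` of added edges per leaf. Let T₁ have girth `g + 1`
with `r` added edges per leaf, and T₂ girth `g` with as many added edges per leaf as T₁ has leaves.
Replace each leaf of T₂ by a copy of T₁ and hand out its added edges, one to each leaf of the copy.
A cycle inside a copy is long; any other contracts to an even edge set of T₂ and also uses an edge
inside a copy. Contraction need not send cycles to cycles, hence even edge sets throughout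
(`EvenGirth.of_contraction`, `evenGirth_subst`). -/

open Classical in
/-- A symmetric finite set of darts of `G` in which every vertex has even degree. -/
def SimpleGraph.IsEvenDarts {V : Type*} (G : SimpleGraph V) (D : Finset (V × V)) : Prop :=
  (∀ p ∈ D, G.Adj p.1 p.2) ∧ (∀ p ∈ D, p.swap ∈ D) ∧
    ∀ x, Even (D.filter (fun p => p.1 = x)).card

/-- Every nonempty even set of edges of `G` has at least `g` edges. -/
def SimpleGraph.EvenGirth {V : Type*} (G : SimpleGraph V) (g : ℕ) : Prop :=
  ∀ D, G.IsEvenDarts D → D.Nonempty → 2 * g ≤ D.card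

/-! ### Even edge sets, girth and contractions -/

namespace SimpleGraph

open Classical in
theorem IsEvenDarts.exists_ne {V : Type*} {G : SimpleGraph V} {D : Finset (V × V)}
    (hD : G.IsEvenDarts D) {p : V × V} (hp : p ∈ D) : ∃ q ∈ D, q.1 = p.1 ∧ q.2 ≠ p.2 := by
  by_contra! h
  have hrow : D.filter (fun q => q.1 = p.1) = {p} := by
    ext q
    rw [Finset.mem_filter, Finset.mem_singleton]
    constructor
    · rintro ⟨hq, h1⟩
      exact Prod.ext h1 (h q hq h1)
    · rintro rfl
      exact ⟨hp, rfl⟩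
  have h1 := hD.2.2 p.1
  rw [hrow] at h1
  simp at h1

-- A cycle is a closed trail, so its edges meet every vertex an even number of times; both
-- orientations of them form an even set of darts.
open Classical in
theorem EvenGirth.le_egirth {V : Type*} {G : SimpleGraph V} {g : ℕ} (hG : G.EvenGirth g) :
    (g : ℕ∞) ≤ G.egirth := by
  rw [_root_.SimpleGraph.le_egirth]
  intro a w hw
  have hmem : ∀ x y, (x, y) ∈ (w.darts.map (fun e => e.toProd) ++
      w.darts.map (fun e => e.toProd.swap)).toFinset ↔ s(x, y) ∈ w.edges := by
    intro x y
    simp only [List.mem_toFinset, List.mem_append, List.mem_map, Walk.edges]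
    constructor
    · rintro (⟨⟨⟨u, v⟩, huv⟩, he, h⟩ | ⟨⟨⟨u, v⟩, huv⟩, he, h⟩)
      · obtain ⟨rfl, rfl⟩ := Prod.mk.inj h
        exact ⟨_, he, rfl⟩
      · obtain ⟨rfl, rfl⟩ := Prod.mk.inj h
        exact ⟨_, he, Sym2.eq_swap⟩
    · rintro ⟨⟨⟨u, v⟩, huv⟩, he, h⟩
      rcases Sym2.eq_iff.1 (show s(u, v) = s(x, y) from h) with ⟨rfl, rfl⟩ | ⟨rfl, rfl⟩
      · exact Or.inl ⟨_, he, rfl⟩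
      · exact Or.inr ⟨_, he, rfl⟩
  set D := (w.darts.map (fun e => e.toProd) ++
      w.darts.map (fun e => e.toProd.swap)).toFinset with hD
  have hev : G.IsEvenDarts D := by
    refine ⟨?_, ?_, ?_⟩
    · rintro ⟨x, y⟩ h
      exact w.edges_subset_edgeSet ((hmem x y).1 h)
    · rintro ⟨x, y⟩ h
      rw [hmem] at h
      rw [Prod.swap_prod_mk, hmem, Sym2.eq_swap]
      exact h
    · intro x
      have h1 := (hw.isTrail.even_countP_edges_iff x).2 (fun h => absurd rfl h)
      rw [List.countP_eq_length_filter] at h1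
      have h2 : (w.edges.filter (fun e => x ∈ e)).length =
          (w.edges.filter (fun e => x ∈ e)).toFinset.card :=
        (List.toFinset_card_of_nodup (hw.isTrail.edges_nodup.filter _)).symm
      rw [h2] at h1
      convert h1 using 1
      refine Finset.card_bij (fun p _ => s(p.1, p.2)) ?_ ?_ ?_
      · rintro ⟨y, z⟩ h
        obtain ⟨hyz, hyx⟩ := Finset.mem_filter.1 h
        replace hyx : y = x := hyx
        subst hyx
        simpa using (hmem _ _).1 hyz
      · rintro ⟨y, z⟩ h ⟨y', z'⟩ h' e
        replace h : y = x := (Finset.mem_filter.1 h).2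
        replace h' : y' = x := (Finset.mem_filter.1 h').2
        subst h h'
        dsimp only at e
        rw [Sym2.congr_right] at e
        rw [e]
      · intro e he
        simp only [List.mem_toFinset, List.mem_filter, decide_eq_true_eq] at he
        obtain ⟨he, y, rfl⟩ := he
        exact ⟨(x, y), by simpa using (hmem _ _).2 he, rfl⟩
  have hne : D.Nonempty := by
    obtain ⟨e, he⟩ := List.exists_mem_of_ne_nil w.edges (by
      intro h
      exact hw.not_nil (Walk.edges_eq_nil.1 h))
    induction e with
    | h x y => exact ⟨(x, y), (hmem _ _).2 he⟩
  have h1 := hG D hev hne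
  have h2 : D.card ≤ 2 * w.length := by
    refine (List.toFinset_card_le _).trans ?_
    simp [two_mul]
  exact_mod_cast (by omega : g ≤ w.length)

open Classical in
theorem EvenGirth.le_card_of_injOn {V W : Type*} {G : SimpleGraph V} {H : SimpleGraph W} {g : ℕ}
    (hH : H.EvenGirth g) {D : Finset (V × V)} (hD : G.IsEvenDarts D) (hne : D.Nonempty)
    (s : Set V) (f : V → W) (hf : Set.InjOn f s) (hs : ∀ p ∈ D, p.1 ∈ s)
    (hadj : ∀ p ∈ D, H.Adj (f p.1) (f p.2)) : 2 * g ≤ D.card := by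
  have hs2 : ∀ p ∈ D, p.2 ∈ s := fun p hp => hs _ (hD.2.1 p hp)
  have hinj : Set.InjOn (Prod.map f f) (D : Set (V × V)) := by
    intro p hp q hq h
    exact Prod.ext (hf (hs p hp) (hs q hq) (congrArg Prod.fst h))
      (hf (hs2 p hp) (hs2 q hq) (congrArg Prod.snd h))
  rw [← Finset.card_image_of_injOn hinj]
  refine hH _ ⟨?_, ?_, ?_⟩ (hne.image _)
  · intro p hp
    obtain ⟨q, hq, rfl⟩ := Finset.mem_image.1 hp
    exact hadj q hq
  · intro p hp
    obtain ⟨q, hq, rfl⟩ := Finset.mem_image.1 hp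
    exact Finset.mem_image.2 ⟨q.swap, hD.2.1 q hq, rfl⟩
  · intro x
    by_cases hx : ∃ p ∈ D, f p.1 = x
    · obtain ⟨p, hp, rfl⟩ := hx
      rw [Finset.filter_image, Finset.card_image_of_injOn (hinj.mono (Finset.coe_subset.2 (Finset.filter_subset _ _)))]
      convert hD.2.2 p.1 using 2
      refine Finset.filter_congr fun q hq => ?_
      exact ⟨fun h => hf (hs q hq) (hs p hp) h, fun h => congrArg f h⟩
    · suffices h : (D.image (Prod.map f f)).filter (fun p => p.1 = x) = ∅ by
        rw [h]
        exact Even.zero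
      rw [Finset.filter_eq_empty_iff]
      intro q hq h
      obtain ⟨q, hq', rfl⟩ := Finset.mem_image.1 hq
      exact hx ⟨q, hq', h⟩

open Classical in
/-- A symmetric irreflexive finite relation has an even number of pairs. -/
theorem even_card_of_symm {V : Type*} {D : Finset (V × V)} (hs : ∀ p ∈ D, p.swap ∈ D)
    (hirr : ∀ p ∈ D, p.1 ≠ p.2) : Even D.card := by
  rw [← ZMod.natCast_eq_zero_iff_even, Finset.card_eq_sum_ones, Nat.cast_sum]
  refine Finset.sum_involution (fun p _ => p.swap) ?_ ?_ hs ?_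
  · intro p _
    decide
  · intro p hp _ h
    exact hirr p hp (congrArg Prod.snd h)
  · intro p _
    exact p.swap_swap

open Classical in
/-- Lifting a lower bound on the girth along a contraction `π`. -/
theorem EvenGirth.of_contraction {V W : Type*} {G' : SimpleGraph V} {G : SimpleGraph W}
    (π : V → W) {g : ℕ}
    (hadj : ∀ x y, G'.Adj x y → π x ≠ π y → G.Adj (π x) (π y))
    (hinj : ∀ x y x' y', G'.Adj x y → G'.Adj x' y' → π x = π x' → π y = π y' → π x ≠ π y →
      x = x' ∧ y = y')
    (hfib : ∀ D v, G'.IsEvenDarts D → D.Nonempty → (∀ p ∈ D, π p.1 = v ∧ π p.2 = v) →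
      2 * (g + 1) ≤ D.card)
    (hG : G.EvenGirth g)
    (hspecial : ∀ D, G.IsEvenDarts D → D.Nonempty → ∃ p ∈ D, ∀ x y y', π x = p.1 →
      G'.Adj x y → G'.Adj x y' → π y ≠ p.1 → π y' ≠ p.1 → y = y') :
    G'.EvenGirth (g + 1) := by
  intro D hD hne
  set C := D.filter (fun p => π p.1 ≠ π p.2) with hC
  by_cases hCe : C = ∅
  · have hcr : ∀ p ∈ D, π p.1 = π p.2 := by
      intro p hp
      by_contra h
      exact Finset.notMem_empty p (hCe ▸ Finset.mem_filter.2 ⟨hp, h⟩)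
    obtain ⟨p, hp⟩ := hne
    -- With no crossing darts, the part of `D` in a single fibre is already even.
    refine (hfib (D.filter (fun q => π q.1 = π p.1)) (π p.1) ⟨?_, ?_, ?_⟩
      ⟨p, Finset.mem_filter.2 ⟨hp, rfl⟩⟩ ?_).trans (Finset.card_filter_le _ _)
    · exact fun q hq => hD.1 q (Finset.mem_filter.1 hq).1
    · intro q hq
      obtain ⟨hq, h⟩ := Finset.mem_filter.1 hq
      exact Finset.mem_filter.2 ⟨hD.2.1 q hq, (hcr q hq).symm.trans h⟩
    · intro x
      by_cases hx : π x = π p.1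
      · convert hD.2.2 x using 2
        rw [Finset.filter_filter]
        refine Finset.filter_congr fun q _ => ?_
        exact ⟨fun h => h.2, fun h => ⟨h ▸ hx, h⟩⟩
      · rw [Finset.filter_filter]
        suffices h : D.filter (fun q => π q.1 = π p.1 ∧ q.1 = x) = ∅ by
          rw [h]
          exact Even.zero
        rw [Finset.filter_eq_empty_iff]
        rintro q _ ⟨h1, rfl⟩
        exact hx h1
    · intro q hq
      obtain ⟨hq, h⟩ := Finset.mem_filter.1 hq
      exact ⟨h, (hcr q hq).symm.trans h⟩
  have hCD : ∀ p ∈ C, p ∈ D ∧ π p.1 ≠ π p.2 := fun p hp => Finset.mem_filter.1 hp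
  have hCs : ∀ p ∈ C, p.swap ∈ C := fun p hp =>
    Finset.mem_filter.2 ⟨hD.2.1 p (hCD p hp).1, (hCD p hp).2.symm⟩
  have hinjC : Set.InjOn (Prod.map π π) (C : Set (V × V)) := by
    intro p hp q hq h
    have := hinj p.1 p.2 q.1 q.2 (hD.1 p (hCD p hp).1) (hD.1 q (hCD q hq).1)
      (congrArg Prod.fst h) (congrArg Prod.snd h) (hCD p hp).2
    exact Prod.ext this.1 this.2
  have hEv : G.IsEvenDarts (C.image (Prod.map π π)) := by
    refine ⟨?_, ?_, ?_⟩
    · intro p hp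
      obtain ⟨q, hq, rfl⟩ := Finset.mem_image.1 hp
      exact hadj _ _ (hD.1 q (hCD q hq).1) (hCD q hq).2
    · intro p hp
      obtain ⟨q, hq, rfl⟩ := Finset.mem_image.1 hp
      exact Finset.mem_image.2 ⟨q.swap, hCs q hq, rfl⟩
    · intro v
      rw [Finset.filter_image, Finset.card_image_of_injOn (hinjC.mono (Finset.coe_subset.2 (Finset.filter_subset _ _)))]
      -- The degree of `v` in the image is the degree sum over its fibre minus the darts inside the
      -- fibre; both are even.
      have h1 : Even (D.filter (fun p => π p.1 = v)).card := by
        rw [Finset.card_eq_sum_card_fiberwise (f := Prod.fst)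
          (t := (D.filter (fun p => π p.1 = v)).image Prod.fst)
          (fun p hp => Finset.mem_image_of_mem _ hp)]
        refine Finset.even_sum _ fun x hx => ?_
        obtain ⟨p, hp, rfl⟩ := Finset.mem_image.1 hx
        rw [Finset.filter_filter]
        suffices h : D.filter (fun q => π q.1 = v ∧ q.1 = p.1) = D.filter (fun q => q.1 = p.1) by
          rw [h]
          exact hD.2.2 p.1
        refine Finset.filter_congr fun q _ => ?_
        exact ⟨fun h => h.2, fun h => ⟨h ▸ (Finset.mem_filter.1 hp).2, h⟩⟩
      have h2 : Even (D.filter (fun p => π p.1 = v ∧ π p.2 = v)).card := by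
        refine even_card_of_symm ?_ ?_
        · intro p hp
          obtain ⟨hp, h1, h2⟩ := Finset.mem_filter.1 hp
          exact Finset.mem_filter.2 ⟨hD.2.1 p hp, h2, h1⟩
        · intro p hp
          exact (hD.1 p (Finset.mem_filter.1 hp).1).ne
      have h3 : (D.filter (fun p => π p.1 = v)).card =
          (D.filter (fun p => π p.1 = v ∧ π p.2 = v)).card +
          (C.filter (fun p => (Prod.map π π p).1 = v)).card := by
        rw [← Finset.card_filter_add_card_filter_not (s := D.filter (fun p => π p.1 = v))
          (fun p => π p.2 = v), Finset.filter_filter, Finset.filter_filter, hC,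
          Finset.filter_filter]
        congr 2
        refine Finset.filter_congr fun q _ => ?_
        simp only [Prod.map_fst]
        constructor
        · rintro ⟨rfl, h⟩
          exact ⟨fun e => h e.symm, rfl⟩
        · rintro ⟨h, rfl⟩
          exact ⟨rfl, fun e => h e.symm⟩
      rw [h3, Nat.even_add] at h1
      exact h1.1 h2
  have hCne : C.Nonempty := Finset.nonempty_iff_ne_empty.2 hCe
  have hcard : 2 * g ≤ C.card := by
    rw [← Finset.card_image_of_injOn hinjC]
    exact hG _ hEv (hCne.image _)
  -- If every dart crosses, evenness gives two crossing darts at one vertex over the special end,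
  -- which `hspecial` forbids. Otherwise `D` has a further edge, that is, two more darts.
  by_cases hall : C = D
  · exfalso
    obtain ⟨p, hp, hu⟩ := hspecial _ hEv (hCne.image _)
    obtain ⟨q, hq, rfl⟩ := Finset.mem_image.1 hp
    have hq' := hCD q hq
    obtain ⟨t, ht, h1, h2⟩ := hD.exists_ne hq'.1
    have ht' := hCD t (hall ▸ ht)
    refine h2 (hu q.1 t.2 q.2 rfl (h1 ▸ hD.1 t ht) (hD.1 q hq'.1) (fun h => ?_) hq'.2.symm)
    exact ht'.2 (h1 ▸ h.symm)
  · have hlt : C.card < D.card :=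
      Finset.card_lt_card (Finset.ssubset_iff_subset_ne.2 ⟨Finset.filter_subset _ _, hall⟩)
    have e1 : Even D.card := even_card_of_symm hD.2.1 fun p hp => (hD.1 p hp).ne
    have e2 : Even C.card := even_card_of_symm hCs fun p hp => (hD.1 p (hCD p hp).1).ne
    obtain ⟨a, ha⟩ := e1
    obtain ⟨b, hb⟩ := e2
    omega

end SimpleGraph


/-! ### Augmented trees -/

/-- Out-neighbours in an augmented tree: the vertices are the words of length at most `h`, an
internal vertex points to its children, and a leaf `x` to its ancestors on the levels in `S x`. -/
def AugRel {α : Type*} (h : ℕ) (S : List α → Finset ℕ) (x y : List α) : Prop :=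
  (x.length < h ∧ ∃ a, y = x ++ [a]) ∨ (x.length = h ∧ ∃ n ∈ S x, y = x.take n)

/-- The augmented tree as a graph. -/
def augGraph {α : Type*} (h : ℕ) (S : List α → Finset ℕ) : SimpleGraph (List α) :=
  SimpleGraph.fromRel (AugRel h S)

/-- Every leaf is assigned `r` odd levels above its parent, and the height is even and positive. -/
def IsAug {α : Type*} (h r : ℕ) (S : List α → Finset ℕ) : Prop :=
  Even h ∧ 0 < h ∧ ∀ l, l.length = h → (S l).card = r ∧ ∀ n ∈ S l, Odd n ∧ n + 1 < h

namespace IsAug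

variable {α : Type*} {h r : ℕ} {S : List α → Finset ℕ}

theorem length_cases (hS : IsAug h r S) {x y : List α} (hxy : AugRel h S x y) :
    (x.length < h ∧ y.length = x.length + 1 ∧ ∃ a, y = x ++ [a]) ∨
      (x.length = h ∧ y.length ∈ S x ∧ y.length + 1 < h ∧ y = x.take y.length) := by
  rcases hxy with ⟨hx, a, rfl⟩ | ⟨hx, n, hn, rfl⟩
  · exact Or.inl ⟨hx, by simp, a, rfl⟩
  · have h1 := ((hS.2.2 x hx).2 n hn).2
    have h2 : (x.take n).length = n := by simp; omega
    exact Or.inr ⟨hx, h2.symm ▸ hn, by omega, by rw [h2]⟩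

theorem ne (hS : IsAug h r S) {x y : List α} (hxy : AugRel h S x y) : x ≠ y := by
  rintro rfl
  rcases hS.length_cases hxy with h1 | h1 <;> omega

theorem adj_iff (hS : IsAug h r S) {x y : List α} :
    (augGraph h S).Adj x y ↔ AugRel h S x y ∨ AugRel h S y x := by
  rw [augGraph, SimpleGraph.fromRel_adj, and_iff_right_iff_imp]
  rintro (h1 | h1)
  · exact hS.ne h1
  · exact (hS.ne h1).symm

theorem even_iff (hS : IsAug h r S) {x y : List α} (hxy : AugRel h S x y) :
    Even x.length ↔ ¬ Even y.length := by
  rcases hS.length_cases hxy with ⟨-, h2, -⟩ | ⟨h1, h2, -⟩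
  · rw [h2, Nat.even_add_one, not_not]
  · have h3 := ((hS.2.2 x h1).2 _ h2).1
    rw [h1, Nat.not_even_iff_odd]
    exact ⟨fun _ => h3, fun _ => hS.1⟩

/-- The internal vertices of an augmented tree span a forest. -/
theorem exists_leaf_mem (hS : IsAug h r S) {D : Finset (List α × List α)}
    (hD : (augGraph h S).IsEvenDarts D) (hne : D.Nonempty) : ∃ p ∈ D, p.1.length = h := by
  obtain ⟨p, hp, hmax⟩ := D.exists_max_image (fun p => p.1.length) hne
  refine ⟨p, hp, ?_⟩
  by_contra hlt
  -- A deepest vertex of `D` that is not a leaf could have only its parent as a neighbour in `D`,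
  -- contradicting even degree.
  have key : ∀ q ∈ D, q.1 = p.1 → q.2 = p.1.dropLast := by
    intro q hq hqp
    have hm : q.2.length ≤ p.1.length := hmax _ (hD.2.1 q hq)
    have hadj := hD.1 q hq
    rw [hqp] at hadj
    rcases hS.adj_iff.1 hadj with h1 | h1
    · rcases hS.length_cases h1 with h2 | h2 <;> omega
    · rcases hS.length_cases h1 with ⟨-, -, a, h2⟩ | h2
      · rw [h2, List.dropLast_concat]
      · omega
  obtain ⟨q, hq, h1, h2⟩ := hD.exists_ne hp
  exact h2 ((key q hq h1).trans (key p hp rfl).symm)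

theorem evenGirth_of_zero (hS : IsAug h 0 S) (g : ℕ) : (augGraph h S).EvenGirth g := by
  intro D hD hne
  exfalso
  obtain ⟨p, hp, hlen⟩ := hS.exists_leaf_mem hD hne
  have key : ∀ q ∈ D, q.1 = p.1 → q.2 = p.1.dropLast := by
    intro q hq hqp
    have hadj := hD.1 q hq
    rw [hqp] at hadj
    rcases hS.adj_iff.1 hadj with h1 | h1
    · rcases hS.length_cases h1 with h2 | ⟨h2, h3, -⟩
      · omega
      · rw [Finset.card_eq_zero.1 (hS.2.2 _ h2).1] at h3
        simp at h3
    · rcases hS.length_cases h1 with ⟨-, -, a, h2⟩ | h2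
      · rw [h2, List.dropLast_concat]
      · omega
  obtain ⟨q, hq, h1, h2⟩ := hD.exists_ne hp
  exact h2 ((key q hq h1).trans (key p hp rfl).symm)

end IsAug

/-! ### Substituting trees for the leaves of a tree -/

open Classical in
/-- Levels for the tree obtained by replacing each leaf of a tree of height `h₂` by a tree with
levels `S₁`, giving each leaf `z` of the copy at `v` the additional level `φ v z`. -/
noncomputable def substLevels {α : Type*} (h₂ : ℕ) (S₁ : List α → Finset ℕ)
    (φ : List α → List α → ℕ) (l : List α) : Finset ℕ :=
  insert (φ (l.take h₂) (l.drop h₂)) ((S₁ (l.drop h₂)).image (· + h₂))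

section Subst

variable {α : Type*} {h₁ h₂ r N g : ℕ} {S₁ S₂ : List α → Finset ℕ} {φ : List α → List α → ℕ}

theorem mem_substLevels {l : List α} {n : ℕ} : n ∈ substLevels h₂ S₁ φ l ↔
    n = φ (l.take h₂) (l.drop h₂) ∨ ∃ m ∈ S₁ (l.drop h₂), m + h₂ = n := by
  simp [substLevels]

theorem IsAug.subst (H₁ : IsAug h₁ r S₁) (H₂ : IsAug h₂ N S₂)
    (hφ : ∀ v z, v.length = h₂ → z.length = h₁ → φ v z ∈ S₂ v) :
    IsAug (h₂ + h₁) (r + 1) (substLevels h₂ S₁ φ) := by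
  classical
  refine ⟨H₂.1.add H₁.1, by have := H₁.2.1; omega, fun l hl => ?_⟩
  have ht : (l.take h₂).length = h₂ := by simp; omega
  have hd : (l.drop h₂).length = h₁ := by simp; omega
  have h1 := (H₂.2.2 _ ht).2 _ (hφ _ _ ht hd)
  constructor
  · rw [substLevels, Finset.card_insert_of_notMem, Finset.card_image_of_injective,
      (H₁.2.2 _ hd).1]
    · exact add_left_injective h₂
    · intro h
      obtain ⟨m, -, h⟩ := Finset.mem_image.1 h
      omega
  · intro n hn
    rcases mem_substLevels.1 hn with rfl | ⟨m, hm, rfl⟩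
    · exact ⟨h1.1, by omega⟩
    · have := (H₁.2.2 _ hd).2 _ hm
      exact ⟨this.1.add_even H₂.1, by omega⟩

/-- The edges of the composed tree that leave a copy of the substituted tree. -/
theorem crossing_cases (H₁ : IsAug h₁ r S₁) (H₂ : IsAug h₂ N S₂)
    (hφ : ∀ v z, v.length = h₂ → z.length = h₁ → φ v z ∈ S₂ v) {x y : List α}
    (hadj : (augGraph (h₂ + h₁) (substLevels h₂ S₁ φ)).Adj x y)
    (hx : h₂ ≤ x.length) (hne : x.take h₂ ≠ y.take h₂) :
    y.length < h₂ ∧ y = x.take y.length ∧ ((x.length = h₂ ∧ y.length + 1 = h₂) ∨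
      (x.length = h₂ + h₁ ∧ y.length = φ (x.take h₂) (x.drop h₂) ∧ y.length + 1 < h₂)) := by
  have H := H₁.subst H₂ hφ
  rcases H.adj_iff.1 hadj with h1 | h1
  · rcases H.length_cases h1 with ⟨-, -, a, rfl⟩ | ⟨h2, h3, h4, h5⟩
    · exact absurd (List.take_append_of_le_length hx).symm hne
    · rcases mem_substLevels.1 h3 with h6 | ⟨m, hm, h6⟩
      · have ht : (x.take h₂).length = h₂ := by simp; omega
        have hd : (x.drop h₂).length = h₁ := by simp; omega
        have h7 := ((H₂.2.2 _ ht).2 _ (hφ _ _ ht hd)).2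
        exact ⟨by omega, h5, Or.inr ⟨h2, h6, by omega⟩⟩
      · refine absurd ?_ hne
        rw [h5, List.take_take, min_eq_left (by omega)]
  · rcases H.length_cases h1 with ⟨-, h3, a, rfl⟩ | ⟨h2, h3, h4, h5⟩
    · have h4 : y.length < h₂ := by
        by_contra h4
        exact hne (List.take_append_of_le_length (not_lt.1 h4))
      exact ⟨h4, by simp, Or.inl ⟨by omega, by omega⟩⟩
    · refine absurd ?_ hne
      rw [h5, List.take_take, min_eq_left (by omega)]

theorem adj_of_crossing (H₁ : IsAug h₁ r S₁) (H₂ : IsAug h₂ N S₂)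
    (hφ : ∀ v z, v.length = h₂ → z.length = h₁ → φ v z ∈ S₂ v) {x y : List α}
    (hadj : (augGraph (h₂ + h₁) (substLevels h₂ S₁ φ)).Adj x y)
    (hx : h₂ ≤ x.length) (hne : x.take h₂ ≠ y.take h₂) :
    (augGraph h₂ S₂).Adj (x.take h₂) (y.take h₂) := by
  obtain ⟨h1, h2, h3⟩ := crossing_cases H₁ H₂ hφ hadj hx hne
  have ht : (x.take h₂).length = h₂ := by simp; omega
  rw [H₂.adj_iff, List.take_of_length_le h1.le]
  rcases h3 with ⟨h3, h4⟩ | ⟨h3, h4, h5⟩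
  · right
    left
    refine ⟨h1, x[y.length], ?_⟩
    have h5 := List.take_concat_get' x y.length (by omega)
    rw [← h2, h4] at h5
    exact h5.symm
  · left
    right
    refine ⟨ht, y.length, ?_, ?_⟩
    · rw [h4]
      exact hφ _ _ ht (by simp; omega)
    · rw [List.take_take, min_eq_left h1.le]
      exact h2

/-- The level of the outer end identifies the inner one: level `h₂ - 1` is reached from the root of
the copy, and a smaller level only from the leaf to which `φ` assigns it. -/
theorem crossing_source_unique (H₁ : IsAug h₁ r S₁) (H₂ : IsAug h₂ N S₂)
    (hφ : ∀ v z, v.length = h₂ → z.length = h₁ → φ v z ∈ S₂ v)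
    (hinj : ∀ v z z', v.length = h₂ → z.length = h₁ → z'.length = h₁ → φ v z = φ v z' → z = z')
    {x y x' y' : List α}
    (hadj : (augGraph (h₂ + h₁) (substLevels h₂ S₁ φ)).Adj x y)
    (hadj' : (augGraph (h₂ + h₁) (substLevels h₂ S₁ φ)).Adj x' y')
    (hx : x.take h₂ = x'.take h₂) (hy : y.take h₂ = y'.take h₂) (hne : x.take h₂ ≠ y.take h₂) :
    x = x' := by
  have hl : min h₂ x.length = min h₂ x'.length := by
    simpa using congrArg List.length hx
  have hl' : min h₂ y.length = min h₂ y'.length := by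
    simpa using congrArg List.length hy
  rcases lt_or_ge x.length h₂ with hlt | hge
  · rwa [List.take_of_length_le hlt.le, List.take_of_length_le (by omega)] at hx
  · obtain ⟨h1, h2, h3⟩ := crossing_cases H₁ H₂ hφ hadj hge hne
    obtain ⟨h1', h2', h3'⟩ := crossing_cases H₁ H₂ hφ hadj' (by omega) (hx ▸ hy ▸ hne)
    rcases h3 with ⟨h3, h4⟩ | ⟨h3, h4, h5⟩
    · have h6 : x'.length = h₂ := by omega
      rwa [List.take_of_length_le h3.le, List.take_of_length_le h6.le] at hx
    · rcases h3' with h3' | ⟨h3', h4', h5'⟩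
      · omega
      · rw [← List.take_append_drop h₂ x, ← List.take_append_drop h₂ x', hx]
        congr 1
        refine hinj (x'.take h₂) _ _ (by simp; omega) (by simp; omega) (by simp; omega) ?_
        rw [← h4', ← hx, ← h4]
        omega

theorem adj_of_fibre (H₁ : IsAug h₁ r S₁) (H₂ : IsAug h₂ N S₂)
    (hφ : ∀ v z, v.length = h₂ → z.length = h₁ → φ v z ∈ S₂ v) {x y : List α}
    (hadj : AugRel (h₂ + h₁) (substLevels h₂ S₁ φ) x y)
    (hx : h₂ ≤ x.length) (hy : h₂ ≤ y.length) : AugRel h₁ S₁ (x.drop h₂) (y.drop h₂) := by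
  have H := H₁.subst H₂ hφ
  rcases H.length_cases hadj with ⟨h1, -, a, rfl⟩ | ⟨h2, h3, h4, h5⟩
  · left
    refine ⟨by simp; omega, a, ?_⟩
    rw [List.drop_append_of_le_length hx]
  · right
    refine ⟨by simp; omega, ?_⟩
    rcases mem_substLevels.1 h3 with h6 | ⟨m, hm, h6⟩
    · have ht : (x.take h₂).length = h₂ := by simp; omega
      have hd : (x.drop h₂).length = h₁ := by simp; omega
      have h7 := ((H₂.2.2 _ ht).2 _ (hφ _ _ ht hd)).2
      omega
    · refine ⟨m, hm, ?_⟩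
      rw [h5, List.drop_take, ← h6, Nat.add_sub_cancel]

theorem evenGirth_subst (H₁ : IsAug h₁ r S₁) (H₂ : IsAug h₂ N S₂)
    (hφ : ∀ v z, v.length = h₂ → z.length = h₁ → φ v z ∈ S₂ v)
    (hinj : ∀ v z z', v.length = h₂ → z.length = h₁ → z'.length = h₁ → φ v z = φ v z' → z = z')
    (hG₁ : (augGraph h₁ S₁).EvenGirth (g + 1)) (hG₂ : (augGraph h₂ S₂).EvenGirth g) :
    (augGraph (h₂ + h₁) (substLevels h₂ S₁ φ)).EvenGirth (g + 1) := by
  have H := H₁.subst H₂ hφ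
  refine SimpleGraph.EvenGirth.of_contraction (fun l => l.take h₂) ?_ ?_ ?_ hG₂ ?_
  · intro x y hadj hne
    rcases le_or_gt h₂ x.length with hx | hx
    · exact adj_of_crossing H₁ H₂ hφ hadj hx hne
    rcases le_or_gt h₂ y.length with hy | hy
    · exact (adj_of_crossing H₁ H₂ hφ hadj.symm hy hne.symm).symm
    have key : ∀ x y : List α, x.length < h₂ → y.length < h₂ →
        AugRel (h₂ + h₁) (substLevels h₂ S₁ φ) x y → AugRel h₂ S₂ x y := by
      intro x y hx hy hxy
      rcases H.length_cases hxy with ⟨-, -, h1⟩ | h1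
      · exact Or.inl ⟨hx, h1⟩
      · omega
    rw [List.take_of_length_le hx.le, List.take_of_length_le hy.le, H₂.adj_iff]
    exact (H.adj_iff.1 hadj).imp (key x y hx hy) (key y x hy hx)
  · intro x y x' y' hadj hadj' hx hy hne
    exact ⟨crossing_source_unique H₁ H₂ hφ hinj hadj hadj' hx hy hne,
      crossing_source_unique H₁ H₂ hφ hinj hadj.symm hadj'.symm hy hx hne.symm⟩
  · intro D v hD hne hv
    have hlen : ∀ p ∈ D, h₂ ≤ p.1.length ∧ h₂ ≤ p.2.length := by
      intro p hp
      obtain ⟨h1, h2⟩ := hv p hp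
      have hl : min h₂ p.1.length = min h₂ p.2.length := by
        simpa using congrArg List.length (h1.trans h2.symm)
      by_contra hc
      have h3 : p.1 = p.2 := by
        have h4 := h1.trans h2.symm
        rwa [List.take_of_length_le (by omega), List.take_of_length_le (by omega)] at h4
      exact (hD.1 p hp).ne h3
    refine hG₁.le_card_of_injOn hD hne {x | x.take h₂ = v} (fun l => l.drop h₂) ?_
      (fun p hp => (hv p hp).1) ?_
    · intro x hx y hy h
      rw [← List.take_append_drop h₂ x, ← List.take_append_drop h₂ y,
        show x.take h₂ = v from hx, show y.take h₂ = v from hy,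
        show x.drop h₂ = y.drop h₂ from h]
    · intro p hp
      rw [H₁.adj_iff]
      exact (H.adj_iff.1 (hD.1 p hp)).imp
        (fun h => adj_of_fibre H₁ H₂ hφ h (hlen p hp).1 (hlen p hp).2)
        (fun h => adj_of_fibre H₁ H₂ hφ h (hlen p hp).2 (hlen p hp).1)
  · intro D hD hne
    obtain ⟨p, hp, hlen⟩ := H₂.exists_leaf_mem hD hne
    refine ⟨p, hp, fun x y y' hx hy hy' hny hny' => ?_⟩
    have hxl : h₂ ≤ x.length := by
      have : min h₂ x.length = h₂ := by simpa [hlen] using congrArg List.length hx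
      omega
    obtain ⟨h1, h2, h3⟩ := crossing_cases H₁ H₂ hφ hy hxl (hx.trans_ne hny.symm)
    obtain ⟨h1', h2', h3'⟩ := crossing_cases H₁ H₂ hφ hy' hxl (hx.trans_ne hny'.symm)
    -- As `h₁ > 0`, the root of a copy is not one of its leaves, so no vertex has both kinds of
    -- crossing edge.
    have := H₁.2.1
    rw [h2, h2', show y.length = y'.length by omega]

end Subst

/-! ### Augmented trees of large girth -/

/-- Augmented complete `d`-ary trees of arbitrarily large girth. -/
theorem exists_isAug_evenGirth (d g r : ℕ) : ∃ (h : ℕ) (S : List (Fin d) → Finset ℕ),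
    IsAug h r S ∧ (augGraph h S).EvenGirth g := by
  induction g generalizing r with
  | zero =>
    -- The bound 0 is void, so every leaf may use the levels 1, 3, …, `2 * r - 1`.
    refine ⟨2 * r + 2, fun _ => (Finset.range r).image (fun i => 2 * i + 1),
      ⟨⟨r + 1, by ring⟩, by omega, fun l _ => ⟨?_, ?_⟩⟩, fun D _ _ => by simp⟩
    · rw [Finset.card_image_of_injective, Finset.card_range]
      intro a b hab
      dsimp only at hab
      omega
    · intro n hn
      obtain ⟨i, hi, rfl⟩ := Finset.mem_image.1 hn
      rw [Finset.mem_range] at hi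
      exact ⟨⟨i, rfl⟩, by omega⟩
  | succ g ihg =>
    induction r with
    | zero =>
      have H : IsAug 2 0 (fun _ : List (Fin d) => (∅ : Finset ℕ)) :=
        ⟨even_two, by omega, fun l _ => by simp⟩
      exact ⟨2, _, H, H.evenGirth_of_zero _⟩
    | succ r ihr =>
      obtain ⟨h₁, S₁, H₁, hG₁⟩ := ihr
      -- One level per leaf of the first tree, so that each leaf of a copy receives exactly one.
      obtain ⟨h₂, S₂, H₂, hG₂⟩ := ihg (Fintype.card (List.Vector (Fin d) h₁))
      have hemb : ∀ v : List (Fin d), ∃ f : List (Fin d) → ℕ, v.length = h₂ →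
          (∀ z, z.length = h₁ → f z ∈ S₂ v) ∧
          ∀ z z', z.length = h₁ → z'.length = h₁ → f z = f z' → z = z' := by
        intro v
        by_cases hv : v.length = h₂
        · have e' : List.Vector (Fin d) h₁ ≃ S₂ v :=
            Fintype.equivOfCardEq (by rw [Fintype.card_coe, (H₂.2.2 v hv).1])
          have e : {l : List (Fin d) // l.length = h₁} ≃ S₂ v := e'
          refine ⟨fun z => if hz : z.length = h₁ then (e ⟨z, hz⟩ : ℕ) else 0, fun _ => ⟨?_, ?_⟩⟩
          · intro z hz
            simp only [dif_pos hz]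
            exact (e _).2
          · intro z z' hz hz' h
            simp only [dif_pos hz, dif_pos hz'] at h
            exact congrArg Subtype.val (e.injective (Subtype.ext h))
        · exact ⟨fun _ => 0, fun h => absurd h hv⟩
      choose φ hφ using hemb
      have hφ1 : ∀ v z, v.length = h₂ → z.length = h₁ → φ v z ∈ S₂ v :=
        fun v z hv hz => (hφ v hv).1 z hz
      exact ⟨h₂ + h₁, substLevels h₂ S₁ φ, H₁.subst H₂ hφ1, evenGirth_subst H₁ H₂ hφ1
        (fun v z z' hv => (hφ v hv).2 z z') hG₁ hG₂⟩


/-! ### Average degree from an orientation -/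

open Classical in
/-- If all out-degrees are at most `d`, except for one more at a vertex `ρ` that reaches everything,
then every proper subgraph has average degree at most `2 * d`. -/
theorem SimpleGraph.Subgraph.averageDegree_le_of_outDegree {V : Type*} [Fintype V]
    {R : V → V → Prop} {d : ℕ} {ρ : V}
    (hout : ∀ x, (Finset.univ.filter (R x)).card ≤ d + if x = ρ then 1 else 0)
    (hreach : ∀ s : Set V, ρ ∈ s → (∀ x ∈ s, ∀ y, R x y → y ∈ s) → ∀ x, x ∈ s)
    (H : (SimpleGraph.fromRel R).Subgraph) (hH : H ≠ ⊤) (hne : H.verts.Nonempty) :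
    H.averageDegree ≤ 2 * d := by
  have hdeg : ∀ v [Fintype (H.neighborSet v)],
      H.degree v = (Finset.univ.filter (H.Adj v)).card := by
    intro v _
    rw [← H.finset_card_neighborSet_eq_degree]
    congr 1
    ext w
    simp
  set W : Finset V := Finset.univ.filter (· ∈ H.verts) with hW
  have hcard : Fintype.card H.verts = W.card := Fintype.card_subtype _
  have hpos : 0 < W.card := by
    obtain ⟨v, hv⟩ := hne
    exact Finset.card_pos.2 ⟨v, by simpa [hW] using hv⟩
  have hsum : ∑ v : H.verts, (H.degree v : ℝ) =
      ((∑ v ∈ W, (Finset.univ.filter (H.Adj v)).card : ℕ) : ℝ) := by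
    rw [Nat.cast_sum, hW, Finset.sum_subtype (p := (· ∈ H.verts)) _ (by simp)]
    exact Finset.sum_congr rfl fun v _ => by rw [hdeg]
  -- Out-degrees within `H`: each edge of `H` is counted from a tail, so the degree sum is at most
  -- twice their sum.
  let o : V → ℕ := fun x => (Finset.univ.filter (fun y => R x y ∧ H.Adj x y)).card
  have hsplit : ∑ v ∈ W, (Finset.univ.filter (H.Adj v)).card ≤ 2 * ∑ v ∈ W, o v := by
    have h1 : ∀ v, (Finset.univ.filter (H.Adj v)).card ≤
        o v + (Finset.univ.filter (fun y => R y v ∧ H.Adj y v)).card := by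
      intro v
      refine le_trans (Finset.card_le_card ?_) (Finset.card_union_le _ _)
      intro y hy
      have hy : H.Adj v y := (Finset.mem_filter.1 hy).2
      rw [Finset.mem_union, Finset.mem_filter, Finset.mem_filter]
      rcases ((SimpleGraph.fromRel_adj R v y).1 hy.adj_sub).2 with h | h
      · exact Or.inl ⟨Finset.mem_univ _, h, hy⟩
      · exact Or.inr ⟨Finset.mem_univ _, h, hy.symm⟩
    have h2 : ∑ v, (Finset.univ.filter (fun y => R y v ∧ H.Adj y v)).card = ∑ v, o v :=
      (Finset.sum_card_bipartiteAbove_eq_sum_card_bipartiteBelow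
        (fun x y => R x y ∧ H.Adj x y)).symm
    have h3 : ∑ v, o v = ∑ v ∈ W, o v := by
      refine (Finset.sum_subset (Finset.subset_univ _) fun v _ hv => ?_).symm
      refine Finset.card_eq_zero.2 (Finset.filter_eq_empty_iff.2 fun y _ h => hv ?_)
      exact Finset.mem_filter.2 ⟨Finset.mem_univ _, h.2.fst_mem⟩
    calc _ ≤ ∑ v ∈ W, (o v + (Finset.univ.filter (fun y => R y v ∧ H.Adj y v)).card) :=
          Finset.sum_le_sum fun v _ => h1 v
      _ ≤ ∑ v ∈ W, o v + ∑ v, (Finset.univ.filter (fun y => R y v ∧ H.Adj y v)).card := by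
          rw [Finset.sum_add_distrib]
          exact Nat.add_le_add_left
            (Finset.sum_le_sum_of_subset (Finset.subset_univ _)) _
      _ = 2 * ∑ v ∈ W, o v := by rw [h2, h3, two_mul]
  have ho : ∀ x, o x ≤ (Finset.univ.filter (R x)).card := fun x =>
    Finset.card_le_card (Finset.monotone_filter_right _ fun y _ h => h.1)
  have hbound : ∑ v ∈ W, o v ≤ d * W.card := by
    by_cases hρ : ρ ∈ H.verts
    -- If no out-edge were missing, `H` would be closed under `R` and contain ρ, hence be
    -- everything. The missing edge pays for the extra one at ρ.
    · have hex : ∃ x ∈ W, o x < (Finset.univ.filter (R x)).card := by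
        by_contra! hall
        refine hH ?_
        have hfull : ∀ x ∈ H.verts, ∀ y, R x y → H.Adj x y := by
          intro x hx y hxy
          have h1 : Finset.univ.filter (fun y => R x y ∧ H.Adj x y) = Finset.univ.filter (R x) :=
            Finset.eq_of_subset_of_card_le (Finset.monotone_filter_right _ fun y _ h => h.1)
              (hall x (Finset.mem_filter.2 ⟨Finset.mem_univ _, hx⟩))
          have h2 : y ∈ Finset.univ.filter (fun y => R x y ∧ H.Adj x y) := by
            rw [h1]
            exact Finset.mem_filter.2 ⟨Finset.mem_univ _, hxy⟩
          exact (Finset.mem_filter.1 h2).2.2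
        have hmem := hreach H.verts hρ fun x hx y hxy => (hfull x hx y hxy).snd_mem
        refine SimpleGraph.Subgraph.ext (Set.eq_univ_of_forall hmem) ?_
        ext x y
        refine ⟨fun h => h.adj_sub, fun h => ?_⟩
        rcases ((SimpleGraph.fromRel_adj R x y).1 h).2 with h | h
        · exact hfull x (hmem x) y h
        · exact (hfull y (hmem y) x h).symm
      obtain ⟨x, hx, hlt⟩ := hex
      have h1 : ∑ v ∈ W, o v < ∑ v ∈ W, (d + if v = ρ then 1 else 0) :=
        Finset.sum_lt_sum (fun v _ => (ho v).trans (hout v)) ⟨x, hx, hlt.trans_le (hout x)⟩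
      have h2 : ∑ v ∈ W, (if v = ρ then 1 else 0) ≤ 1 := by
        rw [Finset.sum_ite_eq']
        split_ifs <;> simp
      rw [Finset.sum_add_distrib, Finset.sum_const, smul_eq_mul, mul_comm] at h1
      omega
    · rw [mul_comm, ← smul_eq_mul]
      refine Finset.sum_le_card_nsmul _ _ _ fun v hv => (ho v).trans ((hout v).trans ?_)
      rw [if_neg, Nat.add_zero]
      rintro rfl
      exact hρ (Finset.mem_filter.1 hv).2
  have havg : H.averageDegree =
      ((∑ v ∈ W, (Finset.univ.filter (H.Adj v)).card : ℕ) : ℝ) / (W.card : ℝ) := by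
    rw [SimpleGraph.Subgraph.averageDegree, ← hcard, ← hsum]
    congr!
  rw [havg, div_le_iff₀ (by exact_mod_cast hpos)]
  have := hsplit.trans (Nat.mul_le_mul_left 2 hbound)
  rw [← mul_assoc] at this
  exact_mod_cast this

/-! ### Lists that force the colour of the root -/

open Classical in
/-- The list of a vertex of an augmented tree: a vertex, used as a color, records that its parent
has chosen it. -/
noncomputable def augList {α : Type*} [Fintype α] (h : ℕ) (S : List α → Finset ℕ) (x : List α) :
    Finset (List α) :=
  insert x (if x.length < h then Finset.univ.image (fun a => x ++ [a])
    else (S x).image (fun n => x.take (n + 1)))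

/-- For a leaf, `n + 1 < h` is what separates the colours `x.take (n + 1)` from `x` itself. -/
theorem IsAug.card_augList {α : Type*} [Fintype α] {h r : ℕ} {S : List α → Finset ℕ}
    (hS : IsAug h r S) (hr : Fintype.card α = r) {x : List α} (hx : x.length ≤ h) :
    (augList h S x).card = r + 1 := by
  classical
  rw [augList]
  split_ifs with hlt
  · rw [Finset.card_insert_of_notMem, Finset.card_image_of_injective, Finset.card_univ,
      hr]
    · intro a b hab
      simpa using hab
    · simp
  · have hx : x.length = h := by omega
    obtain ⟨h1, h2⟩ := hS.2.2 x hx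
    rw [Finset.card_insert_of_notMem, Finset.card_image_of_injOn, h1]
    · intro m hm n hn hmn
      have := h2 m hm
      have := h2 n hn
      have := congrArg List.length hmn
      simp only [List.length_take] at this
      omega
    · intro hmem
      obtain ⟨n, hn, h3⟩ := Finset.mem_image.1 hmem
      have := h2 n hn
      have := congrArg List.length h3
      simp only [List.length_take] at this
      omega

theorem IsAug.not_colorable_from_augList {α : Type*} [Fintype α] {h r : ℕ}
    {S : List α → Finset ℕ} (hS : IsAug h r S) (F E : List α → ℕ)
    (hL : ∀ x, x.length ≤ h → ∃ y ∈ augList h S x, F x = E y)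
    (hadj : ∀ x y, AugRel h S x y → F x ≠ F y) : F [] = E [] := by
  classical
  by_contra h0
  -- A vertex avoiding its own colour takes that of a child, which must then avoid it too; the path
  -- continues to a leaf.
  have key : ∀ n ≤ h, ∃ x : List α, x.length = n ∧ F x ≠ E x ∧
      ∀ m < n, F (x.take m) = E (x.take (m + 1)) := by
    intro n
    induction n with
    | zero => exact fun _ => ⟨[], rfl, h0, fun m hm => absurd hm (Nat.not_lt_zero m)⟩
    | succ n ih =>
      intro hn
      obtain ⟨x, hx, hne, hpath⟩ := ih (by omega)
      obtain ⟨y, hy, hFy⟩ := hL x (by omega)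
      rw [augList, if_pos (by omega), Finset.mem_insert] at hy
      rcases hy with rfl | hy
      · exact absurd hFy hne
      obtain ⟨a, -, rfl⟩ := Finset.mem_image.1 hy
      refine ⟨x ++ [a], by simp [hx], ?_, ?_⟩
      · rw [← hFy]
        exact (hadj _ _ (Or.inl ⟨by omega, a, rfl⟩)).symm
      · intro m hm
        rw [List.take_append_of_le_length (by omega)]
        rcases Nat.lt_succ_iff_lt_or_eq.1 hm with hm | rfl
        · rw [List.take_append_of_le_length (by omega)]
          exact hpath m hm
        · rw [List.take_of_length_le hx.le, List.take_of_length_le (by simp [hx])]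
          exact hFy
  obtain ⟨x, hx, hne, hpath⟩ := key h le_rfl
  obtain ⟨y, hy, hFy⟩ := hL x hx.le
  rw [augList, if_neg (by omega), Finset.mem_insert] at hy
  rcases hy with rfl | hy
  · exact hne hFy
  obtain ⟨n, hn, rfl⟩ := Finset.mem_image.1 hy
  refine hadj x (x.take n) (Or.inr ⟨hx, n, hn, rfl⟩) ?_
  -- The ancestor on level `n`, a neighbour of the leaf, already has the colour of its child on the
  -- path.
  rw [hFy, hpath n (by have := ((hS.2.2 x hx).2 n hn).2; omega)]

/-! ### Joining copies to a new root -/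

/-- Out-neighbours after joining `k` disjoint copies of an augmented tree to a new root. -/
def rootedRel {α : Type*} (k h : ℕ) (S : List α → Finset ℕ) :
    Option (Fin k × {l : List α // l.length ≤ h}) →
      Option (Fin k × {l : List α // l.length ≤ h}) → Prop
  | none, some q => q.2.1 = []
  | some p, some q => p.1 = q.1 ∧ AugRel h S p.2.1 q.2.1
  | _, none => False

section Rooted

variable {α : Type*} {k h r : ℕ} {S : List α → Finset ℕ}

theorem IsAug.rootedRel_ne (hS : IsAug h r S)
    {u v : Option (Fin k × {l : List α // l.length ≤ h})} (huv : rootedRel k h S u v) :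
    u ≠ v := by
  rintro rfl
  cases u with
  | none => exact huv
  | some p => exact hS.ne huv.2 rfl

theorem IsAug.rooted_isBipartite (hS : IsAug h r S) :
    (SimpleGraph.fromRel (rootedRel k h S)).IsBipartite := by
  classical
  let c : Option (Fin k × {l : List α // l.length ≤ h}) → Bool
    | none => false
    | some p => decide (Even p.2.1.length)
  have hc : ∀ u v, rootedRel k h S u v → c u ≠ c v := by
    rintro (_ | p) (_ | q) huv
    · exact huv.elim
    · have : q.2.1 = [] := huv
      simp [c, this]
    · exact huv.elim
    · intro he
      have h1 := hS.even_iff huv.2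
      have h2 : Even p.2.1.length ↔ Even q.2.1.length := by simpa [c] using he
      tauto
  have C : (SimpleGraph.fromRel (rootedRel k h S)).Coloring Bool :=
    SimpleGraph.Coloring.mk c fun {u v} huv => by
      rcases ((SimpleGraph.fromRel_adj _ u v).1 huv).2 with h1 | h1
      · exact hc u v h1
      · exact (hc v u h1).symm
  exact C.colorable

/-- A star has no nonempty even set of edges. -/
theorem evenGirth_star {β : Type*} (g : ℕ) :
    (SimpleGraph.fromRel (fun (a _ : Option β) => a = none)).EvenGirth g := by
  intro D hD hne
  exfalso
  have key : ∃ p ∈ D, p.1 ≠ none := by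
    obtain ⟨p, hp⟩ := hne
    by_cases h1 : p.1 = none
    · refine ⟨p.swap, hD.2.1 p hp, fun h2 => ?_⟩
      exact (hD.1 p hp).ne (h1.trans h2.symm)
    · exact ⟨p, hp, h1⟩
  obtain ⟨p, hp, h1⟩ := key
  have hnone : ∀ q ∈ D, q.1 = p.1 → q.2 = none := by
    intro q hq hqp
    rcases ((SimpleGraph.fromRel_adj _ _ _).1 (hD.1 q hq)).2 with h2 | h2
    · exact absurd (hqp.symm.trans h2) h1
    · exact h2
  obtain ⟨q, hq, h2, h3⟩ := hD.exists_ne hp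
  exact h3 ((hnone q hq h2).trans (hnone p hp rfl).symm)

/-- Contracting each copy leaves a star, which has no nonempty even set, so nothing new arises
outside the copies. -/
theorem IsAug.rooted_evenGirth (hS : IsAug h r S) {g : ℕ}
    (hG : (augGraph h S).EvenGirth (g + 1)) :
    (SimpleGraph.fromRel (rootedRel k h S)).EvenGirth (g + 1) := by
  have hcross : ∀ u v, rootedRel k h S u v → u.map Prod.fst ≠ v.map Prod.fst →
      u = none ∧ ∃ p : Fin k × {l : List α // l.length ≤ h}, v = some p ∧ p.2.1 = [] := by
    rintro (_ | p) (_ | q) huv hne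
    · exact huv.elim
    · exact ⟨rfl, q, rfl, huv⟩
    · exact huv.elim
    · exact absurd (congrArg some huv.1) hne
  have hadjc : ∀ u v, (SimpleGraph.fromRel (rootedRel k h S)).Adj u v →
      u.map Prod.fst ≠ v.map Prod.fst →
      (u = none ∧ ∃ p : Fin k × {l : List α // l.length ≤ h}, v = some p ∧ p.2.1 = []) ∨
      (v = none ∧ ∃ p : Fin k × {l : List α // l.length ≤ h}, u = some p ∧ p.2.1 = []) := by
    intro u v huv hne
    exact ((SimpleGraph.fromRel_adj _ _ _).1 huv).2.imp (fun h1 => hcross u v h1 hne)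
      (fun h1 => hcross v u h1 hne.symm)
  have hstar := evenGirth_star (β := Fin k)
  refine SimpleGraph.EvenGirth.of_contraction (fun u => u.map Prod.fst) ?_ ?_ ?_ (hstar g) ?_
  · intro u v huv hne
    refine (SimpleGraph.fromRel_adj _ _ _).2 ⟨hne, ?_⟩
    rcases hadjc u v huv hne with ⟨rfl, -⟩ | ⟨rfl, -⟩
    · exact Or.inl rfl
    · exact Or.inr rfl
  · have hsome : ∀ p q : Fin k × {l : List α // l.length ≤ h}, p.1 = q.1 → p.2.1 = [] →
        q.2.1 = [] → p = q := fun p q h1 h2 h3 => Prod.ext h1 (Subtype.ext (h2.trans h3.symm))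
    intro u v u' v' huv huv' hu hv hne
    have hne' : u'.map Prod.fst ≠ v'.map Prod.fst := fun e => hne (hu.trans (e.trans hv.symm))
    rcases hadjc u v huv hne with ⟨rfl, p, rfl, hp⟩ | ⟨rfl, p, rfl, hp⟩ <;>
      rcases hadjc u' v' huv' hne' with ⟨rfl, q, rfl, hq⟩ | ⟨rfl, q, rfl, hq⟩
    · exact ⟨rfl, congrArg some (hsome p q (Option.some.inj hv) hp hq)⟩
    · simp at hu
    · simp at hu
    · exact ⟨congrArg some (hsome p q (Option.some.inj hu) hp hq), rfl⟩
  · intro D v hD hne hv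
    cases v with
    | none =>
      obtain ⟨p, hp⟩ := hne
      obtain ⟨h1, h2⟩ := hv p hp
      exact absurd ((Option.map_eq_none_iff.1 h1).trans (Option.map_eq_none_iff.1 h2).symm)
        (hD.1 p hp).ne
    | some i =>
      let f : Option (Fin k × {l : List α // l.length ≤ h}) → List α
        | none => []
        | some p => p.2.1
      refine hG.le_card_of_injOn hD hne {u | u.map Prod.fst = some i} f ?_
        (fun p hp => (hv p hp).1) ?_
      · rintro (_ | p) hp (_ | q) hq hpq
        · rfl
        · simp at hp
        · simp at hq
        · have h1 : some p.1 = some i := hp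
          have h2 : some q.1 = some i := hq
          exact congrArg some (Prod.ext (Option.some.inj (h1.trans h2.symm)) (Subtype.ext hpq))
      · have hf : ∀ u v, u.map Prod.fst = some i → rootedRel k h S u v →
            AugRel h S (f u) (f v) := by
          rintro (_ | p) (_ | q) hu huv
          · exact huv.elim
          · simp at hu
          · exact huv.elim
          · exact huv.2
        intro p hp
        rw [hS.adj_iff]
        exact ((SimpleGraph.fromRel_adj _ _ _).1 (hD.1 p hp)).2.imp
          (hf _ _ (hv p hp).1) (hf _ _ (hv p hp).2)
  · intro D hD hne
    -- The star satisfies every girth bound, so one exceeding the size of `D` is absurd.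
    have h1 := hstar (D.card + 1) D hD hne
    omega

theorem IsAug.rooted_reachable (s : Set (Option (Fin k × {l : List α // l.length ≤ h})))
    (h0 : none ∈ s) (hs : ∀ u ∈ s, ∀ v, rootedRel k h S u v → v ∈ s) (u) : u ∈ s := by
  rcases u with _ | ⟨i, l, hl⟩
  · exact h0
  · induction l using List.reverseRecOn with
    | nil => exact hs none h0 _ rfl
    | append_singleton l a ih =>
      have hl' : l.length < h := by simpa using hl
      exact hs _ (ih hl'.le) _ ⟨rfl, Or.inl ⟨hl', a, rfl⟩⟩

end Rooted

/-! ### Out-degrees, non-choosability and the theorem -/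

section Final

variable {d h : ℕ} {S : List (Fin d) → Finset ℕ}

theorem IsAug.exists_outset (hS : IsAug h d S) (x : List (Fin d)) :
    ∃ T : Finset (List (Fin d)), T.card ≤ d ∧ ∀ y, AugRel h S x y → y ∈ T := by
  classical
  rcases eq_or_ne x.length h with hx | hx
  · refine ⟨(S x).image (fun n => x.take n),
      Finset.card_image_le.trans (hS.2.2 x hx).1.le, ?_⟩
    rintro y (⟨h1, -⟩ | ⟨-, n, hn, rfl⟩)
    · omega
    · exact Finset.mem_image_of_mem _ hn
  · refine ⟨Finset.univ.image (fun a => x ++ [a]), Finset.card_image_le.trans (by simp), ?_⟩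
    rintro y (⟨-, a, rfl⟩ | ⟨h1, -⟩)
    · exact Finset.mem_image_of_mem _ (Finset.mem_univ a)
    · exact absurd h1 hx

open Classical in
theorem IsAug.rooted_outDegree_le (hS : IsAug h d S)
    [Fintype (Option (Fin (d + 1) × {l : List (Fin d) // l.length ≤ h}))]
    (u : Option (Fin (d + 1) × {l : List (Fin d) // l.length ≤ h})) :
    (Finset.univ.filter (rootedRel (d + 1) h S u)).card ≤ d + if u = none then 1 else 0 := by
  cases u with
  | none =>
    rw [if_pos rfl]
    have hsub : Finset.univ.filter (rootedRel (d + 1) h S none) ⊆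
        Finset.univ.image (fun i : Fin (d + 1) => some (i, ⟨[], Nat.zero_le h⟩)) := by
      rintro (_ | q) hq
      · exact (Finset.mem_filter.1 hq).2.elim
      · have h1 : q.2.1 = [] := (Finset.mem_filter.1 hq).2
        exact Finset.mem_image.2 ⟨q.1, Finset.mem_univ _,
          congrArg some (Prod.ext rfl (Subtype.ext h1.symm))⟩
    exact (Finset.card_le_card hsub).trans (Finset.card_image_le.trans (by simp))
  | some p =>
    refine le_trans ?_ (Nat.le_add_right d _)
    obtain ⟨T, hT, hmem⟩ := hS.exists_outset p.2.1
    refine (Finset.card_le_card_of_injOn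
      (fun v => v.elim [] (fun q => q.2.1)) ?_ ?_).trans hT
    · rintro (_ | q) hq
      · exact (Finset.mem_filter.1 hq).2.elim
      · exact hmem _ (Finset.mem_filter.1 hq).2.2
    · rintro (_ | q) hq (_ | q') hq' heq
      · rfl
      · exact (Finset.mem_filter.1 hq).2.elim
      · exact (Finset.mem_filter.1 hq').2.elim
      · exact congrArg some (Prod.ext
          ((Finset.mem_filter.1 hq).2.1.symm.trans (Finset.mem_filter.1 hq').2.1)
          (Subtype.ext heq))

/-- The new root's colour is the own colour of the root of some copy `i`; that root is forced to
take it as well, and the two are adjacent. -/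
theorem IsAug.rooted_not_isChoosable (hS : IsAug h d S) :
    ¬ (SimpleGraph.fromRel (rootedRel (d + 1) h S)).IsChoosable (d + 1) := by
  classical
  intro hch
  obtain ⟨e, he⟩ := exists_injective_nat (Fin (d + 1) × List (Fin d))
  let L : Option (Fin (d + 1) × {l : List (Fin d) // l.length ≤ h}) → Finset ℕ
    | none => Finset.univ.image (fun i => e (i, []))
    | some p => (augList h S p.2.1).image (fun y => e (p.1, y))
  obtain ⟨f, hf⟩ := hch L (by
    rintro (_ | p)
    · rw [Finset.card_image_of_injective, Finset.card_univ, Fintype.card_fin]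
      exact fun a b hab => (Prod.mk.inj (he hab)).1
    · rw [Finset.card_image_of_injective, hS.card_augList (Fintype.card_fin d) p.2.2]
      exact fun a b hab => (Prod.mk.inj (he hab)).2)
  have hval : ∀ u v, rootedRel (d + 1) h S u v → f u ≠ f v := fun u v huv =>
    f.valid ((SimpleGraph.fromRel_adj _ _ _).2 ⟨hS.rootedRel_ne huv, Or.inl huv⟩)
  obtain ⟨i, -, hi⟩ := Finset.mem_image.1 (hf none)
  let F : List (Fin d) → ℕ := fun x => if hx : x.length ≤ h then f (some (i, ⟨x, hx⟩)) else 0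
  have hF : ∀ x (hx : x.length ≤ h), F x = f (some (i, ⟨x, hx⟩)) := fun x hx => dif_pos hx
  have h0 : F [] = e (i, []) := by
    refine hS.not_colorable_from_augList F (fun y => e (i, y)) ?_ ?_
    · intro x hx
      obtain ⟨y, hy, hxy⟩ := Finset.mem_image.1 (hf (some (i, ⟨x, hx⟩)))
      exact ⟨y, hy, by rw [hF x hx, ← hxy]⟩
    · intro x y hxy
      have hlen : x.length ≤ h ∧ y.length ≤ h := by
        rcases hS.length_cases hxy with h1 | h1 <;> omega
      rw [hF x hlen.1, hF y hlen.2]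
      exact hval _ _ ⟨rfl, hxy⟩
  refine hval none (some (i, ⟨[], Nat.zero_le h⟩)) rfl ?_
  rw [← hF, h0]
  exact hi.symm

end Final

theorem mainTheorem2 (g k : ℕ) :
    ∃ (V : Type) (_ : Fintype V) (G : SimpleGraph V),
      G.IsBipartite ∧
      (g : ℕ∞) ≤ G.egirth ∧
      ¬ G.IsChoosable k ∧
      ∀ H : G.Subgraph, H ≠ ⊤ → H.verts.Nonempty →
        H.averageDegree ≤ 2 * ((k : ℝ) - 1) := by
  cases k with
  | zero =>
    -- For `k = 0` the bound is negative, so there must be no nonempty proper subgraph: a single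
    -- vertex, with an empty list.
    refine ⟨Unit, inferInstance, ⊥, ?_, ?_, ?_, ?_⟩
    · exact ⟨SimpleGraph.Coloring.mk (fun _ => 0) fun h => h.elim⟩
    · rw [SimpleGraph.egirth_bot]
      exact le_top
    · intro hch
      obtain ⟨f, hf⟩ := hch (fun _ => ∅) (fun _ => rfl)
      exact absurd (hf ()) (Finset.notMem_empty _)
    · rintro H hH ⟨v, hv⟩
      refine absurd (SimpleGraph.Subgraph.ext (Set.eq_univ_of_forall fun _ => hv) ?_) hH
      ext x y
      exact ⟨fun h => h.adj_sub, fun h => absurd (Subsingleton.elim x y) h.ne⟩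
  | succ d =>
    obtain ⟨h, S, hS, hG⟩ := exists_isAug_evenGirth d (g + 1) d
    have : Finite {l : List (Fin d) // l.length ≤ h} := List.finite_length_le (Fin d) h
    refine ⟨Option (Fin (d + 1) × {l : List (Fin d) // l.length ≤ h}), Fintype.ofFinite _,
      SimpleGraph.fromRel (rootedRel (d + 1) h S), hS.rooted_isBipartite, ?_,
      hS.rooted_not_isChoosable, ?_⟩
    · refine le_trans ?_ (hS.rooted_evenGirth hG).le_egirth
      exact_mod_cast Nat.le_succ g
    · intro H hH hne
      let _ := Fintype.ofFinite (Option (Fin (d + 1) × {l : List (Fin d) // l.length ≤ h}))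
      have := H.averageDegree_le_of_outDegree
        (fun x => by convert hS.rooted_outDegree_le x) IsAug.rooted_reachable hH hne
      rw [Nat.cast_succ, add_sub_cancel_right]
      exact this
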